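/- Let $\mathbb{F}_q$ be a finite field, let $F=\mathbb{F}_q(x)$ be the rational function field, and let $m$ be a positive integer such that $\mathbb{F}_q$ contains a primitive $m$-th root of unity $\omega_m$ (so $\gcd(m,q)=1$). Let $u(x)\in\mathbb{F}_q[x]$ be a square-free polynomial whose degree $d=\deg u$ is relatively prime to $m$, and let $E=F(y)$ with $y^m=u(x)$. For a place $P$ of a function field over $\mathbb{F}_q$ let $\nu_P$ be its normalized discrete valuation (trivial on $\mathbb{F}_q^*$), $\mathcal{O}_P=\{z:\nu_P(z)\ge 0\}$ its valuation ring, and $\deg P$ the degree over $\mathbb{F}_q$ of its residue class field; $P$ is rational if $\deg P=1$. A place $P$ of $E$ lies above a place $Q$ of $F$ if $\mathcal{O}_P\cap F=\mathcal{O}_Q$. Then: (i) The extension $E/F$ is Galois of degree $[E:F]=m$, and its Galois group is isomorphic to the cyclic group $\langle\omega_m\rangle$; more precisely, there is an isomorphism $\phi:\mathrm{Gal}(E/F)\to\langle\omega_m\rangle$ with $\sigma(y)=\phi(\sigma)\,y$ for every $\sigma\in\mathrm{Gal}(E/F)$. (ii) $x$ has a unique pole $Q_\infty$ among the places of $F$;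 it is rational and totally ramified in $E/F$, that is, there is exactly one place $P_\infty$ of $E$ above $Q_\infty$, and its ramification index is $[E:F]$. Moreover $\nu_{P_\infty}(x)=-m$ and $\nu_{P_\infty}(y)=-d$. (iii) For every place $Q\neq Q_\infty$ of $F$, $\{1,y,\dots,y^{m-1}\}$ is an integral basis of $E/F$ at $Q$, that is, a basis of the integral closure of $\mathcal{O}_Q$ in $E$ as an $\mathcal{O}_Q$-module. (iv) If $Q$ is a rational place of $F$ such that $u(Q)=\alpha^m$ for some $\alpha\in\mathbb{F}_q^*$ (that is, $u\in\mathcal{O}_Q$ and its residue class at $Q$ is $\alpha^m$), then $Q$ splits completely in $E/F$, that is, there are exactly $[E:F]$ places of $E$ above $Q$. -/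

import Mathlib

open scoped WithZero

noncomputable section

/-- A place of a function field `K / k`, given by its normalized discrete valuation
(written multiplicatively, with values in `ℤᵐ⁰ = {0} ∪ {exp n | n ∈ ℤ}`): it is onto `ℤᵐ⁰` and
trivial on the nonzero constants.  By normalization, a place is determined by its ring `𝒪_P`. -/
@[ext]
structure Place (k K : Type*) [Field k] [Field K] [Algebra k K] where
  /-- the multiplicative valuation, `val z = exp (-ν_P(z))` -/
  val : Valuation K ℤᵐ⁰
  surjective_val : Function.Surjective val
  val_algebraMap : ∀ a : k, a ≠ 0 → val (algebraMap k K a) = 1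

namespace Place

section Basic

variable {k K : Type*} [Field k] [Field K] [Algebra k K]

open Classical in
/-- The discrete valuation `ν_P : K → ℤ ∪ {∞}` of a place. -/
def ord (P : Place k K) (z : K) : WithTop ℤ :=
  if z = 0 then ⊤ else ((-(WithZero.log (P.val z)) : ℤ) : WithTop ℤ)

/-- The valuation ring `𝒪_P` of a place. -/
abbrev integers (P : Place k K) : ValuationSubring K := P.val.valuationSubring

theorem mem_integers_iff (P : Place k K) (z : K) : z ∈ P.integers ↔ 0 ≤ P.ord z := by
  rw [Valuation.mem_valuationSubring_iff, ord]
  split_ifs with h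
  · simp [h]
  · have h0 : P.val z ≠ 0 := (Valuation.ne_zero_iff _).2 h
    rw [← WithTop.coe_zero, WithTop.coe_le_coe, Left.nonneg_neg_iff, ← WithZero.log_one,
      WithZero.log_le_log h0 one_ne_zero]

theorem algebraMap_mem (P : Place k K) (a : k) : algebraMap k K a ∈ P.integers := by
  rw [Valuation.mem_valuationSubring_iff]
  by_cases h : a = 0
  · simp [h]
  · exact (P.val_algebraMap a h).le

/-- The residue class field `𝒪_P / P`. -/
abbrev residueField (P : Place k K) : Type _ := IsLocalRing.ResidueField P.integers

/-- The embedding of the constants `k → 𝒪_P → 𝒪_P / P`. -/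
def constEmbedding (P : Place k K) : k →+* P.residueField :=
  (IsLocalRing.residue P.integers).comp
    ((algebraMap k K).codRestrict P.integers P.algebraMap_mem)

/-- The degree of a place: the degree of its residue class field over the constants. -/
def degree (P : Place k K) : ℕ :=
  letI : Algebra k P.residueField := P.constEmbedding.toAlgebra
  Module.finrank k P.residueField

/-- A rational place is a place of degree one. -/
def IsRational (P : Place k K) : Prop := P.degree = 1

/-- `f(P) = a`: the function `f` is regular at `P` and its residue class at `P` is
the constant `a`. -/
def EvalEq (P : Place k K) (f : K) (a : k) : Prop :=
  ∃ h : f ∈ P.integers,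
    IsLocalRing.residue P.integers ⟨f, h⟩ = P.constEmbedding a

/-- `P` is a pole of `f`. -/
def IsPole (P : Place k K) (f : K) : Prop := P.ord f < 0

end Basic

section Extension

variable {k F E : Type*} [Field k] [Field F] [Field E] [Algebra k F] [Algebra k E] [Algebra F E]

/-- The place `P` of `E` lies above the place `Q` of `F`: `𝒪_P ∩ F = 𝒪_Q`. -/
def LiesAbove (P : Place k E) (Q : Place k F) : Prop :=
  P.integers.comap (algebraMap F E) = Q.integers

/-- `P` lies above `Q` with ramification index `e`: `ν_P(z) = e · ν_Q(z)` for all `z ∈ F`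
(the case `z = 0` forces `e ≥ 1`). -/
def HasRamificationIndex (P : Place k E) (Q : Place k F) (e : ℕ) : Prop :=
  P.LiesAbove Q ∧ ∀ z : F, P.val (algebraMap F E z) = Q.val z ^ e

variable (E) in
/-- `Q` splits completely in `E / F`: there are exactly `[E : F]` places of `E` above `Q`. -/
def SplitsCompletely (Q : Place k F) : Prop :=
  {P : Place k E | P.LiesAbove Q}.encard = (Module.finrank F E : ℕ∞)

/-- The family `z` is an integral basis of `E / F` at `Q`: it is a basis of the integral closure
of `𝒪_Q` in `E` as an `𝒪_Q`-module. -/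
def IsIntegralBasis (Q : Place k F) {ι : Type*} (z : ι → E) : Prop :=
  LinearIndependent Q.integers z ∧
    Submodule.span Q.integers (Set.range z) =
      Subalgebra.toSubmodule (integralClosure Q.integers E)

end Extension

end Place

end

/-! ### Normalized valuations and their equivalence. -/

noncomputable section

/-! Everything is read off the expansion `z = ∑ c_i y^i` with `i < m`, because `(c_i y^i)^m = c_i^m
u^i` lies in `F`.

At infinity `u` has valuation `-d`, prime to `m`. Taking norms in `y^m = u` gives `m ∣ [E:F]`, hence
equality (`Kummer.finrank_eq_of_valuation`); the rest of (i) is Kummer theory. The nonzero terms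
`c_i y^i` have distinct valuations at a place above infinity, so the largest term decides the
valuation of `z` (`Kummer.exists_val_eq_term`). This gives uniqueness of that place and ramification
index `m`.

At a finite place a square-free `u` has order 0 or 1. Averaging over the Galois group isolates each
term of an integral `z`, and integrality of `c_i^m u^i` forces `c_i` to be integral
(`Kummer.val_coeff_le_one`).

If `u(Q) = α^m`, the factorization of `y^m - α^m` shows that `y` reduces to some `ω^j α` at each
place above `Q`. The integral basis shows that `j` determines the place, and Galois conjugation
realizes every `j`. -/

theorem WithZero.lt_one_iff_le_exp_neg_one {x : ℤᵐ⁰} : x < 1 ↔ x ≤ WithZero.exp (-1) := by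
  rcases eq_or_ne x 0 with rfl | hx
  · simp
  · rw [← WithZero.exp_log hx, ← WithZero.exp_zero, WithZero.exp_lt_exp, WithZero.exp_le_exp]
    omega

theorem Valuation.isEquiv_of_forall {K : Type*} [Field K] {v w : Valuation K ℤᵐ⁰}
    (hle : ∀ z, v z ≤ 1 → w z ≤ 1) (hlt : ∀ z, v z < 1 → w z < 1) : v.IsEquiv w := by
  refine Valuation.isEquiv_iff_val_le_one.2 fun {z} => ⟨hle z, fun h => not_lt.1 fun h' => ?_⟩
  have h1 := hlt z⁻¹ (by rw [map_inv₀]; exact inv_lt_one_of_one_lt₀ h')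
  have hz : z ≠ 0 := by rintro rfl; simp at h'
  rw [map_inv₀] at h1
  exact absurd h1 (not_lt.2 ((one_le_inv₀ (zero_lt_iff.2 ((Valuation.ne_zero_iff _).2 hz))).2 h))

/-- A valuation equivalent to a normalized one is a power of it. -/
theorem Valuation.IsEquiv.exists_eq_pow {K : Type*} [Field K] {v w : Valuation K ℤᵐ⁰}
    (h : w.IsEquiv v) (hv : Function.Surjective v) :
    ∃ e : ℕ, e ≠ 0 ∧ ∀ z, w z = v z ^ e := by
  obtain ⟨t, ht⟩ := hv (WithZero.exp (-1))
  have ht0 : t ≠ 0 := by rintro rfl; exact WithZero.exp_ne_zero (ht.symm.trans v.map_zero)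
  have hw0 : w t ≠ 0 := (Valuation.ne_zero_iff _).2 ht0
  have hwt : w t < 1 := by
    rw [(Valuation.isEquiv_iff_val_lt_one.1 h), ht]
    exact WithZero.lt_one_iff_le_exp_neg_one.2 le_rfl
  have hlog : WithZero.log (w t) < 0 := by
    rwa [← WithZero.exp_log hw0, ← WithZero.exp_zero, WithZero.exp_lt_exp] at hwt
  obtain ⟨e, he⟩ := Int.eq_ofNat_of_zero_le (a := -WithZero.log (w t)) (by omega)
  refine ⟨e, by omega, fun z => ?_⟩
  rcases eq_or_ne z 0 with rfl | hz
  · rw [map_zero, map_zero, zero_pow (by omega)]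
  have hvz : v z ≠ 0 := (Valuation.ne_zero_iff _).2 hz
  -- Since `t` is a uniformizer for `v`, this product is a `v`-unit, hence a `w`-unit; this
  -- expresses `w z` through `w t`.
  have h1 : v (z * t ^ WithZero.log (v z)) = 1 := by
    rw [map_mul, map_zpow₀, ht, ← WithZero.exp_zsmul]
    nth_rw 1 [← WithZero.exp_log hvz]
    rw [← WithZero.exp_add, ← WithZero.exp_zero]
    congr 1
    simp
  have h2 := (Valuation.isEquiv_iff_val_eq_one.1 h).2 h1
  rw [map_mul, map_zpow₀, ← WithZero.exp_log hw0, ← WithZero.exp_zsmul] at h2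
  rw [eq_inv_of_mul_eq_one_left h2, ← WithZero.exp_neg]
  conv_rhs => rw [← WithZero.exp_log hvz, ← WithZero.exp_nsmul]
  congr 1
  simp only [smul_eq_mul, nsmul_eq_mul]
  rw [← mul_neg, he]
  simp [mul_comm]

namespace Place

/-! ### Places, their values and residues. -/

section Basic

variable {k K : Type*} [Field k] [Field K] [Algebra k K]

/-- Equivalence gives a power relation with exponent `e`; surjectivity of `P.val` forces `e ∣ 1`. -/
theorem eq_of_isEquiv {P P' : Place k K} (h : P.val.IsEquiv P'.val) : P = P' := by
  obtain ⟨e, he, hP⟩ := h.exists_eq_pow P'.surjective_val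
  obtain ⟨z, hz⟩ := P.surjective_val (WithZero.exp (-1))
  have h1 := congrArg WithZero.log (hP z)
  rw [hz, WithZero.log_exp, WithZero.log_pow, nsmul_eq_mul] at h1
  have : (e : ℤ) ∣ 1 := ⟨-WithZero.log (P'.val z), by linarith⟩
  have h2 : e = 1 := by
    have := Int.natCast_dvd_natCast.1 (by simpa using this : (e : ℤ) ∣ ((1 : ℕ) : ℤ))
    simpa using this
  ext z
  simp [hP z, h2]

theorem val_ne_zero (P : Place k K) {z : K} (hz : z ≠ 0) : P.val z ≠ 0 :=
  (Valuation.ne_zero_iff _).2 hz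

theorem val_algebraMap_le_one (P : Place k K) (a : k) : P.val (algebraMap k K a) ≤ 1 :=
  P.algebraMap_mem a

theorem ord_of_ne_zero (P : Place k K) {z : K} (hz : z ≠ 0) :
    P.ord z = ((-(WithZero.log (P.val z)) : ℤ) : WithTop ℤ) := if_neg hz

theorem isPole_iff (P : Place k K) (z : K) : P.IsPole z ↔ 1 < P.val z := by
  rw [IsPole, ← not_le, ← not_le, not_iff_not]
  exact (P.mem_integers_iff z).symm

/-- `f(P) = a` in terms of the valuation. -/
theorem evalEq_iff (P : Place k K) (f : K) (a : k) :
    P.EvalEq f a ↔ P.val (f - algebraMap k K a) < 1 := by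
  have key : ∀ h : f ∈ P.integers, (IsLocalRing.residue P.integers ⟨f, h⟩ = P.constEmbedding a ↔
      P.val (f - algebraMap k K a) < 1) := by
    intro h
    rw [constEmbedding, RingHom.comp_apply, ← sub_eq_zero, ← map_sub,
      IsLocalRing.residue_eq_zero_iff]
    exact (P.val.mem_maximalIdeal_iff (a := _)).trans Iff.rfl
  constructor
  · rintro ⟨h, h'⟩
    exact (key h).1 h'
  · intro h
    have hf : f ∈ P.integers := by
      rw [Valuation.mem_valuationSubring_iff]
      have := P.val.map_add (f - algebraMap k K a) (algebraMap k K a)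
      rw [sub_add_cancel] at this
      exact this.trans (max_le h.le (P.val_algebraMap_le_one a))
    exact ⟨hf, (key hf).2 h⟩

theorem isRational_of_forall_exists_evalEq (P : Place k K)
    (h : ∀ z, P.val z ≤ 1 → ∃ a : k, P.EvalEq z a) : P.IsRational := by
  have hs : Function.Surjective P.constEmbedding := by
    intro r
    obtain ⟨⟨z, hz⟩, rfl⟩ := IsLocalRing.residue_surjective r
    obtain ⟨a, _, ha⟩ := h z hz
    exact ⟨a, ha.symm⟩
  unfold IsRational degree
  let : Algebra k P.residueField := P.constEmbedding.toAlgebra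
  rw [← (LinearEquiv.ofBijective (Algebra.linearMap k P.residueField)
    ⟨P.constEmbedding.injective, hs⟩).finrank_eq, Module.finrank_self]

end Basic

/-! ### Places and maximal ideals of Dedekind domains. -/

section Dedekind

open IsDedekindDomain

variable {k K : Type*} [Field k] [Field K] [Algebra k K]
  {B : Type*} [CommRing B] [IsDedekindDomain B] [Algebra B K] [IsFractionRing B K]

/-- The place defined by a maximal ideal of a Dedekind domain containing the constants. -/
def ofHeightOneSpectrum (p : HeightOneSpectrum B)
    (hk : ∀ a : k, algebraMap k K a ∈ Set.range (algebraMap B K)) : Place k K where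
  val := p.valuation K
  surjective_val := p.valuation_surjective K
  val_algebraMap a ha := by
    have hle : ∀ a : k, p.valuation K (algebraMap k K a) ≤ 1 := fun a => by
      obtain ⟨b, hb⟩ := hk a
      exact hb ▸ p.valuation_le_one b
    refine le_antisymm (hle a) ?_
    have h := hle a⁻¹
    have h0 : p.valuation K (algebraMap k K a) ≠ 0 := by simpa using ha
    rw [map_inv₀, map_inv₀] at h
    exact (inv_le_one₀ (zero_lt_iff.2 h0)).1 h

/-- A place nonnegative on a Dedekind domain is the valuation of its center. -/
theorem exists_heightOneSpectrum (P : Place k K) (hB : ∀ b : B, P.val (algebraMap B K b) ≤ 1) :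
    ∃ p : HeightOneSpectrum B, (∀ b, b ∈ p.asIdeal ↔ P.val (algebraMap B K b) < 1) ∧
      p.valuation K = P.val := by
  let I : Ideal B :=
    { carrier := {b | P.val (algebraMap B K b) < 1}
      add_mem' := fun {a b} ha hb => by
        simp only [Set.mem_ofPred_eq, map_add] at *
        exact P.val.map_add_lt ha hb
      zero_mem' := by simp
      smul_mem' := fun c b hb => by
        simp only [Set.mem_ofPred_eq, smul_eq_mul, map_mul] at *
        exact mul_lt_one_of_nonneg_of_lt_one_right (hB c) zero_le hb }
  have hI : ∀ b, b ∈ I ↔ P.val (algebraMap B K b) < 1 := fun _ => Iff.rfl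
  have hprime : I.IsPrime := by
    refine ⟨fun h => ?_, fun {a b} hab => ?_⟩
    · have := (hI 1).1 (h ▸ Submodule.mem_top)
      simp at this
    · by_contra! hcon
      rw [hI, hI, not_lt, not_lt] at hcon
      rw [hI, map_mul, map_mul, le_antisymm (hB a) hcon.1, le_antisymm (hB b) hcon.2] at hab
      simp at hab
  -- With zero center, all nonzero elements of `B`, hence all nonzero fractions, would have value 1,
  -- against surjectivity.
  have hbot : I ≠ ⊥ := by
    intro hbot
    obtain ⟨z, hz⟩ := P.surjective_val (WithZero.exp (-1))
    obtain ⟨a, b, hb, rfl⟩ := IsFractionRing.div_surjective (A := B) z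
    have hunit : ∀ b : B, b ≠ 0 → P.val (algebraMap B K b) = 1 := fun b hb =>
      le_antisymm (hB b) (not_lt.1 fun h => hb (by simpa [hbot] using (hI b).2 h))
    have hb0 := hunit b (nonZeroDivisors.ne_zero hb)
    have ha0 : a ≠ 0 := by rintro rfl; exact WithZero.exp_ne_zero (hz.symm.trans (by simp))
    rw [map_div₀, hunit a ha0, hb0, ← WithZero.exp_zero, ← WithZero.exp_sub] at hz
    simp at hz
  let p : HeightOneSpectrum B := ⟨I, hprime, hbot⟩
  have hfrac : ∀ z : K, p.valuation K z ≤ 1 → ∃ a s : B, P.val (algebraMap B K s) = 1 ∧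
      p.valuation K (algebraMap B K s) = 1 ∧ z * algebraMap B K s = algebraMap B K a := by
    intro z hz
    obtain ⟨a, s, ha⟩ := p.exists_primeCompl_mul_eq_of_integer z hz
    have hs' : (s : B) ∉ I := s.2
    exact ⟨a, s, le_antisymm (hB _) (not_lt.1 hs'), p.valuation_eq_one_iff_notMem.2 hs', ha⟩
  have hle : ∀ z : K, p.valuation K z ≤ 1 → P.val z ≤ 1 := fun z hz => by
    obtain ⟨a, s, hs, -, h⟩ := hfrac z hz
    have := congrArg P.val h
    rw [map_mul, hs, mul_one] at this
    exact this ▸ hB a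
  have hlt : ∀ z : K, p.valuation K z < 1 → P.val z < 1 := fun z hz => by
    obtain ⟨a, s, hs, hps, h⟩ := hfrac z hz.le
    have h1 := congrArg P.val h
    have h2 := congrArg (p.valuation K) h
    rw [map_mul, hs, mul_one] at h1
    rw [map_mul, hps, mul_one] at h2
    rw [h2, p.valuation_lt_one_iff_mem] at hz
    exact h1 ▸ (hI a).1 hz
  refine ⟨p, hI, ?_⟩
  -- `B` need not contain the constants, so triviality on them is transported from `P` through
  -- `hlt`, applied to `a` or its inverse.
  have hk : ∀ a : k, a ≠ 0 → p.valuation K (algebraMap k K a) = 1 := by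
    intro a ha
    have ha' : P.val (algebraMap k K a) = 1 := P.val_algebraMap a ha
    have ha0 : algebraMap k K a ≠ 0 := by simpa using ha
    rcases lt_trichotomy (p.valuation K (algebraMap k K a)) 1 with h | h | h
    · exact absurd (hlt _ h) ha'.not_lt
    · exact h
    · have := hlt (algebraMap k K a)⁻¹ (by rw [map_inv₀]; exact inv_lt_one_of_one_lt₀ h)
      rw [map_inv₀, ha'] at this
      simp at this
  let P' : Place k K := ⟨p.valuation K, p.valuation_surjective K, hk⟩
  refine congrArg Place.val (eq_of_isEquiv (P := P') (P' := P) ?_)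
  exact Valuation.isEquiv_of_forall hle hlt

theorem eq_of_center_eq (B : Type*) [CommRing B] [IsDedekindDomain B] [Algebra B K]
    [IsFractionRing B K] {P P' : Place k K}
    (hP : ∀ b : B, P.val (algebraMap B K b) ≤ 1) (hP' : ∀ b : B, P'.val (algebraMap B K b) ≤ 1)
    (h : ∀ b : B, P.val (algebraMap B K b) < 1 ↔ P'.val (algebraMap B K b) < 1) : P = P' := by
  obtain ⟨p, hp, hpv⟩ := P.exists_heightOneSpectrum hP
  obtain ⟨p', hp', hpv'⟩ := P'.exists_heightOneSpectrum hP'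
  have : p = p' := by
    ext b
    rw [hp, hp', h]
  ext1
  rw [← hpv, ← hpv', this]

end Dedekind

/-! ### Places above a given place: existence and conjugation. -/

section Extension

variable {k F E : Type*} [Field k] [Field F] [Field E] [Algebra k F] [Algebra k E] [Algebra F E]

theorem liesAbove_iff (P : Place k E) (Q : Place k F) :
    P.LiesAbove Q ↔ ∀ z : F, P.val (algebraMap F E z) ≤ 1 ↔ Q.val z ≤ 1 := by
  rw [LiesAbove, SetLike.ext_iff]
  rfl

theorem liesAbove_of_forall (P : Place k E) (Q : Place k F)
    (hle : ∀ z : F, Q.val z ≤ 1 → P.val (algebraMap F E z) ≤ 1)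
    (hlt : ∀ z : F, Q.val z < 1 → P.val (algebraMap F E z) < 1) : P.LiesAbove Q := by
  exact (liesAbove_iff P Q).2 fun z => (Valuation.isEquiv_iff_val_le_one.1
    (Valuation.isEquiv_of_forall (w := P.val.comap (algebraMap F E)) hle hlt)).symm

theorem LiesAbove.exists_hasRamificationIndex {P : Place k E} {Q : Place k F}
    (h : P.LiesAbove Q) : ∃ e : ℕ, e ≠ 0 ∧ P.HasRamificationIndex Q e := by
  have hE : (P.val.comap (algebraMap F E)).IsEquiv Q.val :=
    Valuation.isEquiv_iff_val_le_one.2 fun {z} => (liesAbove_iff P Q).1 h z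
  obtain ⟨e, he, h'⟩ := hE.exists_eq_pow Q.surjective_val
  exact ⟨e, he, h, h'⟩

theorem LiesAbove.val_lt_one_iff {P : Place k E} {Q : Place k F}
    (h : P.LiesAbove Q) (z : F) : P.val (algebraMap F E z) < 1 ↔ Q.val z < 1 := by
  obtain ⟨e, he, -, hP⟩ := h.exists_hasRamificationIndex
  rw [hP, pow_lt_one_iff_of_nonneg zero_le he]

theorem LiesAbove.val_le_one_of_isIntegral {P : Place k E} {Q : Place k F}
    (h : P.LiesAbove Q) {z : E} (hz : IsIntegral Q.integers z) : P.val z ≤ 1 := by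
  have h1 : IsIntegral P.integers z := by
    refine hz.map_of_comp_eq ((algebraMap F E).restrict Q.integers P.integers fun x hx =>
      ((liesAbove_iff P Q).1 h x).2 hx) (RingHom.id E) ?_
    ext x
    rfl
  exact Valuation.Integers.mem_of_integral (Valuation.integer.integers P.val) h1

instance isDiscreteValuationRing_integers (Q : Place k F) :
    IsDiscreteValuationRing Q.integers := by
  have : Nontrivial (MonoidWithZeroHom.valueGroup (.ofClass Q.val)) := by
    obtain ⟨t, ht⟩ := Q.surjective_val (WithZero.exp (-1))
    have : Q.val.IsNontrivial := ⟨t, ht ▸ WithZero.exp_ne_zero, by rw [ht]; simp⟩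
    infer_instance
  have : IsCyclic (MonoidWithZeroHom.valueGroup (.ofClass Q.val)) := by
    infer_instance
  exact Valuation.valuationSubring_isDiscreteValuationRing Q.val

omit [Algebra k E] in
theorem isIntegral_integers_iff (Q : Place k F) (z : F) :
    IsIntegral Q.integers (algebraMap F E z) ↔ Q.val z ≤ 1 := by
  rw [isIntegral_algebraMap_iff (algebraMap F E).injective, IsIntegrallyClosed.isIntegral_iff]
  exact ⟨fun ⟨y, hy⟩ => hy ▸ y.2, fun h => ⟨⟨z, h⟩, rfl⟩⟩

variable (E) in
-- Lying over: a maximal ideal of the integral closure above that of `𝒪_Q` is nonzero, and the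
-- integral closure is Dedekind, so the ideal defines a place.
theorem exists_liesAbove [IsScalarTower k F E] [FiniteDimensional F E]
    [Algebra.IsSeparable F E] (Q : Place k F) :
    ∃ P : Place k E, P.LiesAbove Q := by
  have := integralClosure.isDedekindDomain Q.integers F E
  have := integralClosure.isFractionRing_of_finite_extension (A := Q.integers) F E
  have hinj : Function.Injective (algebraMap Q.integers (integralClosure Q.integers E)) :=
    fun x y hxy => Subtype.ext ((algebraMap F E).injective (congrArg Subtype.val hxy))
  obtain ⟨M, hM, hMQ⟩ := Ideal.exists_ideal_over_maximal_of_isIntegral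
    (S := integralClosure Q.integers E) (IsLocalRing.maximalIdeal Q.integers)
    (by rw [(RingHom.injective_iff_ker_eq_bot _).1 hinj]; exact bot_le)
  have hM0 : M ≠ ⊥ := by
    rintro rfl
    refine IsDiscreteValuationRing.not_a_field Q.integers (hMQ.symm.trans ?_)
    rw [← RingHom.ker_eq_comap_bot]
    exact (RingHom.injective_iff_ker_eq_bot _).1 hinj
  have hmem : ∀ x : Q.integers, algebraMap F E x =
      algebraMap (integralClosure Q.integers E) E (algebraMap Q.integers _ x) := fun x => rfl
  let p : IsDedekindDomain.HeightOneSpectrum (integralClosure Q.integers E) :=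
    ⟨M, hM.isPrime, hM0⟩
  refine ⟨ofHeightOneSpectrum p fun a => ⟨algebraMap Q.integers _ ⟨_, Q.algebraMap_mem a⟩, ?_⟩,
    liesAbove_of_forall _ _ (fun z hz => ?_) fun z hz => ?_⟩
  · rw [← hmem, IsScalarTower.algebraMap_apply k F E]
  · exact (congrArg (p.valuation E) (hmem ⟨z, hz⟩)).trans_le (p.valuation_le_one _)
  · refine (congrArg (p.valuation E) (hmem ⟨z, hz.le⟩)).trans_lt
      ((p.valuation_lt_one_iff_mem _).2 ?_)
    have : (⟨z, hz.le⟩ : Q.integers) ∈ IsLocalRing.maximalIdeal Q.integers :=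
      (Q.val.mem_maximalIdeal_iff (a := _)).2 hz
    rw [← hMQ] at this
    exact this

/-- The conjugate of a place. -/
def conj [IsScalarTower k F E] (P : Place k E) (σ : E ≃ₐ[F] E) : Place k E where
  val := P.val.comap (σ : E →+* E)
  surjective_val := P.surjective_val.comp σ.surjective
  val_algebraMap a ha := by
    have : σ (algebraMap k E a) = algebraMap k E a := by
      rw [IsScalarTower.algebraMap_apply k F E, σ.commutes]
    exact (congrArg P.val this).trans (P.val_algebraMap a ha)

theorem LiesAbove.conj [IsScalarTower k F E] {P : Place k E} {Q : Place k F}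
    (h : P.LiesAbove Q) (σ : E ≃ₐ[F] E) : (P.conj σ).LiesAbove Q :=
  (liesAbove_iff _ _).2 fun z =>
    (congrArg (P.val · ≤ 1) (σ.commutes z)).to_iff.trans ((liesAbove_iff P Q).1 h z)

end Extension
end Place

end

/-! ### Places of the rational function field. -/

noncomputable section

namespace Place

open Polynomial
open scoped Classical

variable {k : Type*} [Field k]

variable (k) in
/-- The place at infinity of the rational function field. -/
def infty : Place k (RatFunc k) where
  val := RatFunc.inftyValuation k
  surjective_val x := by
    rcases eq_or_ne x 0 with rfl | hx
    · exact ⟨0, map_zero _⟩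
    · exact ⟨RatFunc.X ^ WithZero.log x,
        (RatFunc.inftyValuation.X_zpow k _).trans (WithZero.exp_log hx)⟩
  val_algebraMap a ha := RatFunc.inftyValuation.C k ha

theorem val_infty (z : RatFunc k) (hz : z ≠ 0) : (infty k).val z = WithZero.exp z.intDegree :=
  RatFunc.inftyValuation_of_nonzero k hz

theorem val_infty_polynomial (f : k[X]) (hf : f ≠ 0) :
    (infty k).val (algebraMap k[X] (RatFunc k) f) = WithZero.exp (f.natDegree : ℤ) :=
  RatFunc.inftyValuation.polynomial k hf

/-- The leading term strictly dominates. Hence a pole of `x` leaves no freedom in the valuation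
ring, which yields `isPole_X_iff`. -/
theorem val_polynomial_of_isPole (Q : Place k (RatFunc k)) (hQ : Q.IsPole RatFunc.X)
    (f : k[X]) (hf : f ≠ 0) :
    Q.val (algebraMap k[X] (RatFunc k) f) = Q.val RatFunc.X ^ f.natDegree := by
  rw [isPole_iff] at hQ
  have hterm : ∀ i, Q.val (algebraMap k (RatFunc k) (f.coeff i) * RatFunc.X ^ i) =
      if f.coeff i = 0 then 0 else Q.val RatFunc.X ^ i := by
    intro i
    split_ifs with h
    · simp [h]
    · rw [map_mul, Q.val_algebraMap _ h, one_mul, map_pow]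
  have hsum : algebraMap k[X] (RatFunc k) f = ∑ i ∈ Finset.range (f.natDegree + 1),
      algebraMap k (RatFunc k) (f.coeff i) * RatFunc.X ^ i := by
    conv_lhs => rw [f.as_sum_range_C_mul_X_pow]
    simp [RatFunc.algebraMap_eq_C]
  have hlead := hterm f.natDegree
  rw [if_neg (by simpa using hf)] at hlead
  rw [hsum, ← hlead]
  refine Valuation.map_sum_eq_of_lt _ (Finset.mem_range.2 (Nat.lt_succ_self _)) fun i hi => ?_
  rw [hlead, hterm]
  simp only [Finset.mem_sdiff, Finset.mem_range, Finset.mem_singleton] at hi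
  split_ifs
  · exact pow_pos (zero_lt_one.trans hQ) _
  · exact pow_lt_pow_right₀ hQ (by omega)

theorem isPole_infty : (infty k).IsPole RatFunc.X := by
  rw [isPole_iff]
  refine lt_of_lt_of_eq ?_ (RatFunc.inftyValuation.X k).symm
  rw [← WithZero.exp_zero, WithZero.exp_lt_exp]
  exact zero_lt_one

theorem isPole_X_iff (Q : Place k (RatFunc k)) : Q.IsPole RatFunc.X ↔ Q = infty k := by
  refine ⟨fun hQ => ?_, fun h => h ▸ isPole_infty⟩
  refine eq_of_isEquiv (Valuation.isEquiv_iff_val_le_one.2 fun {z} => ?_)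
  rcases eq_or_ne z 0 with rfl | hz
  · simp
  have key : ∀ P : Place k (RatFunc k), P.IsPole RatFunc.X →
      (P.val z ≤ 1 ↔ z.num.natDegree ≤ z.denom.natDegree) := by
    intro P hP
    have hP1 := (P.isPole_iff _).1 hP
    rw [← RatFunc.num_div_denom z, map_div₀,
      P.val_polynomial_of_isPole hP _ (RatFunc.num_ne_zero hz),
      P.val_polynomial_of_isPole hP _ z.denom_ne_zero,
      div_le_one₀ (pow_pos (zero_lt_one.trans hP1) _), pow_le_pow_iff_right₀ hP1,
      RatFunc.num_div_denom]
  rw [key Q hQ, key _ isPole_infty]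

theorem isRational_infty : (infty k).IsRational := by
  refine isRational_of_forall_exists_evalEq _ fun z hz => ?_
  rcases eq_or_ne z 0 with rfl | hz0
  · exact ⟨0, (evalEq_iff _ _ _).2 (by simp)⟩
  rw [val_infty z hz0, ← WithZero.exp_zero, WithZero.exp_le_exp] at hz
  -- The denominator is monic, so subtracting this multiple of it from the numerator cancels the
  -- coefficient in degree `z.denom.natDegree`.
  refine ⟨z.num.coeff z.denom.natDegree, (evalEq_iff _ _ _).2 ?_⟩
  set c := z.num.coeff z.denom.natDegree
  set g := z.num - C c * z.denom
  have hden : algebraMap k[X] (RatFunc k) z.denom ≠ 0 := by simpa using z.denom_ne_zero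
  have hg : z - algebraMap k (RatFunc k) c =
      algebraMap k[X] (RatFunc k) g / algebraMap k[X] (RatFunc k) z.denom := by
    rw [eq_div_iff hden, sub_mul]
    nth_rw 1 [← RatFunc.num_div_denom z]
    rw [div_mul_cancel₀ _ hden]
    simp [g, RatFunc.algebraMap_eq_C]
  rw [hg, map_div₀, val_infty_polynomial _ z.denom_ne_zero]
  rcases eq_or_ne g 0 with h0 | h0
  · simp [h0]
  rw [val_infty_polynomial _ h0, ← WithZero.exp_sub, ← WithZero.exp_zero, WithZero.exp_lt_exp]
  have hnum : z.num.natDegree ≤ z.denom.natDegree := by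
    rw [RatFunc.intDegree] at hz
    omega
  have hle : g.natDegree ≤ z.denom.natDegree :=
    (natDegree_sub_le _ _).trans (max_le hnum (natDegree_C_mul_le _ _))
  have hcoeff : g.coeff z.denom.natDegree = 0 := by
    have := z.monic_denom.coeff_natDegree
    simp [g, c, this]
  have hne : g.natDegree ≠ z.denom.natDegree := fun h => by
    rw [← h] at hcoeff
    exact h0 (by simpa using hcoeff)
  omega

/-- A square-free polynomial vanishes to order at most one at every finite place. -/
theorem val_squarefree (Q : Place k (RatFunc k)) (hQ : Q ≠ infty k) {u : k[X]}
    (hu : Squarefree u) :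
    WithZero.exp (-1) ≤ Q.val (algebraMap k[X] (RatFunc k) u) ∧
      Q.val (algebraMap k[X] (RatFunc k) u) ≤ 1 := by
  have hX : Q.val RatFunc.X ≤ 1 := by
    rw [← not_lt, ← isPole_iff, isPole_X_iff]
    exact hQ
  have hB : ∀ f : k[X], Q.val (algebraMap k[X] (RatFunc k) f) ≤ 1 := by
    intro f
    induction f using Polynomial.induction_on' with
    | add p q hp hq =>
      rw [map_add]
      exact (Q.val.map_add _ _).trans (max_le hp hq)
    | monomial n a =>
      rw [← C_mul_X_pow_eq_monomial, map_mul, map_mul, map_pow, map_pow, RatFunc.algebraMap_X,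
        RatFunc.algebraMap_C, ← RatFunc.algebraMap_eq_C]
      exact mul_le_one' (Q.val_algebraMap_le_one a) (pow_le_one' hX n)
  refine ⟨?_, hB u⟩
  obtain ⟨p, -, hpv⟩ := Q.exists_heightOneSpectrum hB
  rw [← hpv, p.valuation_of_algebraMap, ← not_lt]
  intro hlt
  -- A value below `exp (-1)` means order at least 2, so the square of a generator of the center
  -- divides `u`.
  have h2 : p.intValuation u ≤ WithZero.exp (-((2 : ℕ) : ℤ)) := by
    have h0 := p.intValuation_ne_zero u hu.ne_zero
    rw [← WithZero.exp_log h0] at hlt ⊢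
    rw [WithZero.exp_lt_exp] at hlt
    rw [WithZero.exp_le_exp]
    push_cast
    omega
  rw [p.intValuation_le_pow_iff_mem] at h2
  obtain ⟨π, hπ⟩ := (IsPrincipalIdealRing.principal p.asIdeal).principal
  have hpi : p.asIdeal = Ideal.span {π} := hπ
  rw [hpi, Ideal.span_singleton_pow, Ideal.mem_span_singleton, sq] at h2
  have hunit := hu π h2
  exact p.isPrime.ne_top (hpi.trans (Ideal.span_singleton_eq_top.2 hunit))

end Place

end

/-! ### Kummer theory: degree, Galois group, powers of the root. -/

noncomputable section

namespace Kummer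

open Polynomial

section Field

variable {F E : Type*} [Field F] [Field E] [Algebra F E] {m : ℕ} {a : F} {y : E}

theorem isIntegral_root (hm : 0 < m) (hy : y ^ m = algebraMap F E a) : IsIntegral F y :=
  IsIntegral.of_pow hm (hy ▸ isIntegral_algebraMap)

theorem finiteDimensional (hm : 0 < m) (hy : y ^ m = algebraMap F E a)
    (hE : IntermediateField.adjoin F {y} = ⊤) : FiniteDimensional F E := by
  have := IntermediateField.adjoin.finiteDimensional (isIntegral_root hm hy)
  rw [hE] at this
  exact IntermediateField.topEquiv.toLinearEquiv.finiteDimensional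

theorem natDegree_minpoly (hm : 0 < m) (hy : y ^ m = algebraMap F E a)
    (hE : IntermediateField.adjoin F {y} = ⊤) :
    (minpoly F y).natDegree = Module.finrank F E := by
  rw [← IntermediateField.adjoin.finrank (isIntegral_root hm hy), hE, IntermediateField.finrank_top']

theorem finrank_le (hm : 0 < m) (hy : y ^ m = algebraMap F E a)
    (hE : IntermediateField.adjoin F {y} = ⊤) : Module.finrank F E ≤ m := by
  rw [← natDegree_minpoly hm hy hE, ← natDegree_X_pow_sub_C (n := m) (r := a)]
  exact natDegree_le_of_dvd (minpoly.dvd F y (by simp [hy])) (X_pow_sub_C_ne_zero hm a)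

/-- The extension obtained by adjoining an `m`-th root of `a` has degree `m` as soon as some
valuation of the base with values in `ℤ` takes a value prime to `m` at `a`. -/
theorem finrank_eq_of_valuation (hm : 0 < m) (hy : y ^ m = algebraMap F E a)
    (hE : IntermediateField.adjoin F {y} = ⊤) (v : Valuation F ℤᵐ⁰)
    (hv : IsCoprime (WithZero.log (v a)) m) : Module.finrank F E = m := by
  have := finiteDimensional hm hy hE
  refine le_antisymm (finrank_le hm hy hE) (Nat.le_of_dvd Module.finrank_pos ?_)
  -- Norms turn `y^m = a` into `N(y)^m = a^[E:F]` inside `F`, where `v` applies.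
  have h := congrArg (Algebra.norm F) hy
  rw [map_pow, Algebra.norm_algebraMap] at h
  replace h := congrArg (fun z => WithZero.log (v z)) h
  simp only [map_pow, WithZero.log_pow, nsmul_eq_mul] at h
  exact_mod_cast hv.symm.dvd_of_dvd_mul_right (Dvd.intro _ h)

theorem isGalois (hm : 0 < m) (hy : y ^ m = algebraMap F E a)
    (hE : IntermediateField.adjoin F {y} = ⊤) (hfin : Module.finrank F E = m)
    {ζ : F} (hζ : IsPrimitiveRoot ζ m) : IsGalois F E := by
  have := finiteDimensional hm hy hE
  subst hfin
  have hne : (primitiveRoots (Module.finrank F E) F).Nonempty :=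
    ⟨ζ, (mem_primitiveRoots hm).2 hζ⟩
  have := isSplittingField_X_pow_sub_C_of_root_adjoin_eq_top hne hy hE
  exact isGalois_of_isSplittingField_X_pow_sub_C hne
    (irreducible_X_pow_sub_C_of_root_adjoin_eq_top hy hE) E

theorem linearIndependent_pow (hm : 0 < m) (hy : y ^ m = algebraMap F E a)
    (hE : IntermediateField.adjoin F {y} = ⊤) (hfin : Module.finrank F E = m) :
    LinearIndependent F (fun i : Fin m => y ^ (i : ℕ)) := by
  have h := natDegree_minpoly hm hy hE
  rw [hfin] at h
  have := _root_.linearIndependent_pow (K := F) y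
  rwa [h] at this

theorem exists_eq_sum (hm : 0 < m) (hy : y ^ m = algebraMap F E a)
    (hE : IntermediateField.adjoin F {y} = ⊤) (hfin : Module.finrank F E = m) (z : E) :
    ∃ c : Fin m → F, z = ∑ i, algebraMap F E (c i) * y ^ (i : ℕ) := by
  have : Nonempty (Fin m) := ⟨⟨0, hm⟩⟩
  let b := basisOfLinearIndependentOfCardEqFinrank (linearIndependent_pow hm hy hE hfin)
    (by rw [hfin, Fintype.card_fin])
  refine ⟨b.repr z, ?_⟩
  conv_lhs => rw [← b.sum_repr z]
  simp [b, Algebra.smul_def]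

end Field

variable {k F E : Type*} [Field k] [Field F] [Field E] [Algebra k F] [Algebra k E] [Algebra F E]
  [IsScalarTower k F E] {m : ℕ} {a : F} {y : E}

/-- The Kummer character of the Galois group. -/
theorem exists_mulEquiv (hm : 0 < m) {ω : kˣ} (hω : IsPrimitiveRoot ω m)
    (hy : y ^ m = algebraMap F E a) (ha : a ≠ 0)
    (hE : IntermediateField.adjoin F {y} = ⊤) (hfin : Module.finrank F E = m)
    [IsGalois F E] :
    ∃ φ : (E ≃ₐ[F] E) ≃* Subgroup.zpowers ω,
      ∀ σ : E ≃ₐ[F] E, σ y = algebraMap k E ((φ σ : kˣ) : k) * y := by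
  have := finiteDimensional hm hy hE
  have hy0 : y ≠ 0 := by
    rintro rfl
    rw [zero_pow hm.ne'] at hy
    exact ha (by simpa using hy.symm)
  have : NeZero m := ⟨hm.ne'⟩
  have hωE : IsPrimitiveRoot (algebraMap k E ω) m :=
    (IsPrimitiveRoot.coe_units_iff.2 hω).map_of_injective (algebraMap k E).injective
  have hex : ∀ σ : E ≃ₐ[F] E, ∃ c : Subgroup.zpowers ω,
      σ y = algebraMap k E ((c : kˣ) : k) * y := by
    intro σ
    have h1 : (σ y / y) ^ m = 1 := by
      rw [div_pow, ← map_pow, hy, σ.commutes, div_self]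
      rw [← hy]
      exact pow_ne_zero _ hy0
    obtain ⟨i, -, hi⟩ := hωE.eq_pow_of_pow_eq_one h1
    refine ⟨⟨ω ^ i, Subgroup.npow_mem_zpowers ω i⟩, ?_⟩
    rw [eq_div_iff hy0] at hi
    simp [← hi]
  choose f hf using hex
  have huniq : ∀ c c' : Subgroup.zpowers ω,
      algebraMap k E ((c : kˣ) : k) * y = algebraMap k E ((c' : kˣ) : k) * y → c = c' :=
    fun c c' h => Subtype.ext (Units.ext ((algebraMap k E).injective (mul_right_cancel₀ hy0 h)))
  have hk : ∀ (σ : E ≃ₐ[F] E) (c : k), σ (algebraMap k E c) = algebraMap k E c := fun σ c => by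
    rw [IsScalarTower.algebraMap_apply k F E, σ.commutes]
  let φ : (E ≃ₐ[F] E) →* Subgroup.zpowers ω := MonoidHom.mk' f fun σ τ => huniq _ _ <| by
    rw [← hf, AlgEquiv.mul_apply, hf τ, map_mul, hk, hf σ]
    rw [Subgroup.coe_mul, Units.val_mul, map_mul]
    ring
  have hinj : Function.Injective φ := by
    refine (injective_iff_map_eq_one φ).2 fun σ hσ => ?_
    have h1 : σ y = y := by
      rw [hf σ, show f σ = 1 from hσ]
      simp
    ext z
    obtain ⟨c, rfl⟩ := exists_eq_sum hm hy hE hfin z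
    simp [h1]
  have hcard : Nat.card (E ≃ₐ[F] E) = Nat.card (Subgroup.zpowers ω) := by
    rw [IsGalois.card_aut_eq_finrank, hfin, Nat.card_zpowers, hω.eq_orderOf]
  have : Finite (Subgroup.zpowers ω) := Nat.finite_of_card_ne_zero (by
    rw [Nat.card_zpowers, ← hω.eq_orderOf]; exact hm.ne')
  exact ⟨MulEquiv.ofBijective φ (hinj.bijective_of_nat_card_le hcard.ge), hf⟩

end Kummer
end

/-! ### Total ramification. -/

noncomputable section

/-- A nonzero maximal value is attained only once, so the ultrametric inequality is an equality.
Coincidences are allowed at value zero, to accommodate vanishing coefficients. -/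
theorem Valuation.exists_map_sum_eq {R Γ ι : Type*} [Ring R] [LinearOrderedCommGroupWithZero Γ]
    [Fintype ι] [Nonempty ι] (v : Valuation R Γ) (f : ι → R)
    (hf : ∀ i j, v (f i) ≠ 0 → v (f i) = v (f j) → i = j) :
    ∃ i, v (∑ i, f i) = v (f i) ∧ ∀ j, v (f j) ≤ v (f i) := by
  classical
  obtain ⟨i, hi⟩ := Finite.exists_max fun i => v (f i)
  refine ⟨i, ?_, hi⟩
  rcases eq_or_ne (v (f i)) 0 with h0 | h0
  · rw [h0]
    exact le_antisymm (v.map_sum_le fun j _ => h0 ▸ hi j) zero_le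
  · refine Valuation.map_sum_eq_of_lt _ (Finset.mem_univ i) fun j hj => lt_of_le_of_ne (hi j) ?_
    intro h
    simp only [Finset.mem_sdiff, Finset.mem_singleton] at hj
    exact hj.2 (hf i j h0 h.symm).symm

namespace Kummer

open Place

variable {k F E : Type*} [Field k] [Field F] [Field E] [Algebra k F] [Algebra k E] [Algebra F E]
  [IsScalarTower k F E] {m : ℕ} {a : F} {y : E}

section TotallyRamified

variable {Q : Place k F} {P : Place k E}

omit [IsScalarTower k F E] in
theorem pow_term (hy : y ^ m = algebraMap F E a) (c : F) (i : ℕ) :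
    (algebraMap F E c * y ^ i) ^ m = algebraMap F E (c ^ m * a ^ i) := by
  rw [mul_pow, ← pow_mul, mul_comm i, pow_mul, hy, map_mul, map_pow, map_pow]

omit [IsScalarTower k F E] in
-- Comparing `m`-th powers of two terms of equal nonzero value gives `m ∣ (i - j) * log (Q.val a)`;
-- coprimality and `|i - j| < m` leave `i = j`.
theorem exists_val_eq_term (hm : 0 < m) (hy : y ^ m = algebraMap F E a)
    (hv : IsCoprime (WithZero.log (Q.val a)) m) (hP : P.LiesAbove Q) (c : Fin m → F) :
    ∃ i, P.val (∑ i, algebraMap F E (c i) * y ^ (i : ℕ)) =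
        P.val (algebraMap F E (c i) * y ^ (i : ℕ)) ∧
      ∀ j : Fin m, P.val (algebraMap F E (c j) * y ^ (j : ℕ)) ≤
        P.val (algebraMap F E (c i) * y ^ (i : ℕ)) := by
  have : Nonempty (Fin m) := ⟨⟨0, hm⟩⟩
  refine P.val.exists_map_sum_eq (fun i : Fin m => algebraMap F E (c i) * y ^ (i : ℕ)) ?_
  intro i j hi hij
  obtain ⟨e, he, -, hPe⟩ := hP.exists_hasRamificationIndex
  have hpow := congrArg (· ^ m) hij
  simp only [← map_pow P.val, pow_term hy, hPe] at hpow
  have hj : P.val (algebraMap F E (c j) * y ^ (j : ℕ)) ≠ 0 := hij ▸ hi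
  have hne : ∀ l : Fin m, P.val (algebraMap F E (c l) * y ^ (l : ℕ)) ≠ 0 →
      Q.val (c l) ^ m ≠ 0 ∧ Q.val a ^ (l : ℕ) ≠ 0 := by
    intro l hl
    have h1 : P.val ((algebraMap F E (c l) * y ^ (l : ℕ)) ^ m) ≠ 0 := by
      rw [map_pow]
      exact pow_ne_zero _ hl
    rw [pow_term hy, hPe, pow_ne_zero_iff he, map_mul, map_pow, map_pow] at h1
    exact ⟨left_ne_zero_of_mul h1, right_ne_zero_of_mul h1⟩
  have hlog := congrArg WithZero.log hpow
  simp only [WithZero.log_pow, map_mul, map_pow] at hlog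
  rw [WithZero.log_mul (hne i hi).1 (hne i hi).2, WithZero.log_mul (hne j hj).1 (hne j hj).2] at hlog
  simp only [WithZero.log_pow, nsmul_eq_mul] at hlog
  replace hlog := mul_left_cancel₀ (Nat.cast_ne_zero.2 he) hlog
  have hdvd : (m : ℤ) ∣ ((i : ℕ) : ℤ) - ((j : ℕ) : ℤ) :=
    hv.symm.dvd_of_dvd_mul_right ⟨WithZero.log (Q.val (c j)) - WithZero.log (Q.val (c i)), by
      linear_combination hlog⟩
  have h0 := Int.eq_zero_of_abs_lt_dvd hdvd (by
    rw [abs_lt]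
    constructor <;> omega)
  ext
  omega

omit [IsScalarTower k F E] in
theorem liesAbove_unique (hm : 0 < m) (hy : y ^ m = algebraMap F E a)
    (hE : IntermediateField.adjoin F {y} = ⊤) (hfin : Module.finrank F E = m)
    (hv : IsCoprime (WithZero.log (Q.val a)) m) {P' : Place k E} (hP : P.LiesAbove Q)
    (hP' : P'.LiesAbove Q) : P = P' := by
  refine eq_of_isEquiv (Valuation.isEquiv_iff_val_le_one.2 fun {z} => ?_)
  obtain ⟨c, rfl⟩ := exists_eq_sum hm hy hE hfin z
  -- The criterion on the right involves only `Q`, so all places above `Q` share one valuation ring.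
  have key : ∀ P : Place k E, P.LiesAbove Q →
      (P.val (∑ i, algebraMap F E (c i) * y ^ (i : ℕ)) ≤ 1 ↔
        ∀ i : Fin m, Q.val (c i ^ m * a ^ (i : ℕ)) ≤ 1) := by
    intro P hP
    obtain ⟨i, hi, hmax⟩ := exists_val_eq_term hm hy hv hP c
    have hterm : ∀ j : Fin m, P.val (algebraMap F E (c j) * y ^ (j : ℕ)) ≤ 1 ↔
        Q.val (c j ^ m * a ^ (j : ℕ)) ≤ 1 := fun j => by
      rw [← (liesAbove_iff P Q).1 hP, ← pow_term hy, map_pow,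
        pow_le_one_iff_of_nonneg zero_le hm.ne']
    rw [hi]
    exact ⟨fun h j => (hterm j).1 ((hmax j).trans h), fun h => (hterm i).2 (h i)⟩
  rw [key P hP, key P' hP']

omit [IsScalarTower k F E] in
theorem hasRamificationIndex (hm : 0 < m) (hy : y ^ m = algebraMap F E a)
    (hE : IntermediateField.adjoin F {y} = ⊤) (hfin : Module.finrank F E = m)
    (hv : IsCoprime (WithZero.log (Q.val a)) m) (hP : P.LiesAbove Q) :
    P.HasRamificationIndex Q m := by
  obtain ⟨e, he, -, hPe⟩ := hP.exists_hasRamificationIndex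
  have hylog : (m : ℤ) * WithZero.log (P.val y) = e * WithZero.log (Q.val a) := by
    have := congrArg (fun z => WithZero.log (P.val z)) hy
    simpa [hPe] using this
  have hdvd : (m : ℤ) ∣ e := hv.symm.dvd_of_dvd_mul_right (Dvd.intro _ hylog)
  obtain ⟨t, rfl⟩ := Int.natCast_dvd_natCast.1 hdvd
  have hy' : WithZero.log (P.val y) = t * WithZero.log (Q.val a) := by
    have hm0 : (m : ℤ) ≠ 0 := by exact_mod_cast hm.ne'
    refine mul_left_cancel₀ hm0 (hylog.trans ?_)
    push_cast
    ring
  -- With `e = m * t`, every term has logarithm divisible by `t`; an element of logarithm 1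
  -- therefore forces `t = 1`.
  obtain ⟨z, hz⟩ := P.surjective_val (WithZero.exp 1)
  obtain ⟨c, rfl⟩ := exists_eq_sum hm hy hE hfin z
  obtain ⟨i, hi, -⟩ := exists_val_eq_term hm hy hv hP c
  rw [hz, map_mul, map_pow, hPe] at hi
  have h0 : Q.val (c i) ^ (m * t) * P.val y ^ (i : ℕ) ≠ 0 := hi ▸ WithZero.exp_ne_zero
  have hlog := congrArg WithZero.log hi
  rw [WithZero.log_mul (left_ne_zero_of_mul h0) (right_ne_zero_of_mul h0)] at hlog
  simp only [WithZero.log_pow, nsmul_eq_mul, WithZero.log_exp, hy'] at hlog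
  have ht : (t : ℤ) ∣ 1 := ⟨m * WithZero.log (Q.val (c i)) + i * WithZero.log (Q.val a), by
    rw [hlog]
    push_cast
    ring⟩
  have ht1 : t = 1 := by
    have := Int.natCast_dvd_natCast.1 (by simpa using ht : (t : ℤ) ∣ ((1 : ℕ) : ℤ))
    simpa using this
  subst ht1
  rw [mul_one] at hPe
  exact ⟨hP, hPe⟩

end TotallyRamified

/-! ### The integral basis at finite places. -/

section IntegralBasis

variable {ω : kˣ} (Q : Place k F)

theorem isIntegral_const (c : k) : IsIntegral Q.integers (algebraMap k E c) := by
  rw [IsScalarTower.algebraMap_apply k F E]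
  exact (Place.isIntegral_integers_iff Q _).2 (Q.val_algebraMap_le_one c)

theorem exists_algEquiv (hm : 0 < m) (hω : IsPrimitiveRoot ω m)
    (hy : y ^ m = algebraMap F E a) (ha : a ≠ 0)
    (hE : IntermediateField.adjoin F {y} = ⊤) (hfin : Module.finrank F E = m)
    [IsGalois F E] {c : kˣ} (hc : c ∈ Subgroup.zpowers ω) :
    ∃ σ : E ≃ₐ[F] E, σ y = algebraMap k E c * y := by
  obtain ⟨φ, hφ⟩ := exists_mulEquiv hm hω hy ha hE hfin
  exact ⟨φ.symm ⟨c, hc⟩, by rw [hφ, φ.apply_symm_apply]⟩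

omit [IsScalarTower k F E] in
-- Orthogonality of the characters of the Galois group: the geometric sum over `j` vanishes unless
-- `l = i`.
theorem sum_conj_eq (hm : 0 < m) {ζ : E} (hζ : IsPrimitiveRoot ζ m) (σ : Fin m → E ≃ₐ[F] E)
    (hσ : ∀ j, σ j y = ζ ^ (j : ℕ) * y) (c : Fin m → F) (i : Fin m) :
    ∑ j : Fin m, (ζ ^ (i : ℕ))⁻¹ ^ (j : ℕ) * σ j (∑ l, algebraMap F E (c l) * y ^ (l : ℕ)) =
      m * (algebraMap F E (c i) * y ^ (i : ℕ)) := by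
  have hζ0 : ζ ≠ 0 := hζ.ne_zero hm.ne'
  have hgeom : ∀ l : Fin m, ∑ j : Fin m, (ζ ^ (l : ℕ) / ζ ^ (i : ℕ)) ^ (j : ℕ) =
      if l = i then (m : E) else 0 := by
    intro l
    rw [Fin.sum_univ_eq_sum_range (fun j => (ζ ^ (l : ℕ) / ζ ^ (i : ℕ)) ^ j) m]
    split_ifs with h
    · simp [h, hζ0]
    · have hne : ζ ^ (l : ℕ) / ζ ^ (i : ℕ) ≠ 1 := fun h1 => h <| Fin.ext <|
        hζ.pow_inj l.2 i.2 ((div_eq_one_iff_eq (pow_ne_zero _ hζ0)).1 h1)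
      rw [geom_sum_eq hne, div_pow, ← pow_mul, ← pow_mul, mul_comm, pow_mul, hζ.pow_eq_one,
        mul_comm, pow_mul, hζ.pow_eq_one]
      simp
  calc _ = ∑ j : Fin m, ∑ l : Fin m, (ζ ^ (l : ℕ) / ζ ^ (i : ℕ)) ^ (j : ℕ) *
        (algebraMap F E (c l) * y ^ (l : ℕ)) := by
        refine Finset.sum_congr rfl fun j _ => ?_
        rw [map_sum, Finset.mul_sum]
        refine Finset.sum_congr rfl fun l _ => ?_
        rw [map_mul, AlgEquiv.commutes, map_pow, hσ, mul_pow, div_pow, inv_pow, ← pow_mul,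
          ← pow_mul, ← pow_mul, mul_comm (j : ℕ)]
        ring
    _ = ∑ l : Fin m, (∑ j : Fin m, (ζ ^ (l : ℕ) / ζ ^ (i : ℕ)) ^ (j : ℕ)) *
        (algebraMap F E (c l) * y ^ (l : ℕ)) := by
        rw [Finset.sum_comm]
        exact Finset.sum_congr rfl fun l _ => (Finset.sum_mul _ _ _).symm
    _ = _ := by simp [hgeom]

variable {Q}

/-- The coordinates of an integral element with respect to the powers of `y` are integral. -/
theorem val_coeff_le_one (hm : 0 < m) (hω : IsPrimitiveRoot ω m)
    (hy : y ^ m = algebraMap F E a) (ha : a ≠ 0)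
    (hE : IntermediateField.adjoin F {y} = ⊤) (hfin : Module.finrank F E = m) [IsGalois F E]
    (hQ : WithZero.exp (-1) ≤ Q.val a) (c : Fin m → F)
    (hc : IsIntegral Q.integers (∑ i, algebraMap F E (c i) * y ^ (i : ℕ))) (i : Fin m) :
    Q.val (c i) ≤ 1 := by
  have hωk : IsPrimitiveRoot (ω : k) m := IsPrimitiveRoot.coe_units_iff.2 hω
  have hωE : IsPrimitiveRoot (algebraMap k E ω) m :=
    hωk.map_of_injective (algebraMap k E).injective
  have : NeZero m := ⟨hm.ne'⟩
  have hmk : (m : k) ≠ 0 := (hωk.neZero').out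
  have hmE : (m : E) ≠ 0 := (hωE.neZero').out
  have hex : ∀ j : Fin m, ∃ σ : E ≃ₐ[F] E, σ y = algebraMap k E ω ^ (j : ℕ) * y := fun j => by
    obtain ⟨σ, hσ⟩ := exists_algEquiv hm hω hy ha hE hfin
      (Subgroup.npow_mem_zpowers ω (j : ℕ))
    exact ⟨σ, by rw [hσ]; simp⟩
  choose σ hσ using hex
  have hterm : IsIntegral Q.integers (algebraMap F E (c i) * y ^ (i : ℕ)) := by
    have h1 := sum_conj_eq hm hωE σ hσ c i
    have h2 : algebraMap F E (c i) * y ^ (i : ℕ) = algebraMap k E (m : k)⁻¹ *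
        ∑ j : Fin m, (algebraMap k E ω ^ (i : ℕ))⁻¹ ^ (j : ℕ) *
          σ j (∑ l, algebraMap F E (c l) * y ^ (l : ℕ)) := by
      rw [h1, map_inv₀, map_natCast, inv_mul_cancel_left₀ hmE]
    rw [h2]
    refine (isIntegral_const Q _).mul (IsIntegral.sum _ fun j _ => IsIntegral.mul ?_ ?_)
    · rw [← map_pow, ← map_inv₀, ← map_pow]
      exact isIntegral_const Q _
    · exact hc.map ((σ j).toAlgHom.restrictScalars Q.integers)
  have h3 := hterm.pow m
  rw [pow_term hy, Place.isIntegral_integers_iff, map_mul, map_pow, map_pow] at h3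
  rcases eq_or_ne (c i) 0 with h0 | h0
  · simp [h0]
  have hc0 := Q.val_ne_zero h0
  have ha0 := Q.val_ne_zero ha
  rw [← WithZero.exp_log ha0, WithZero.exp_le_exp] at hQ
  rw [← WithZero.exp_log hc0, ← WithZero.exp_log ha0, ← WithZero.exp_nsmul, ← WithZero.exp_nsmul,
    ← WithZero.exp_add, ← WithZero.exp_zero, WithZero.exp_le_exp, nsmul_eq_mul, nsmul_eq_mul] at h3
  rw [← WithZero.exp_log hc0, ← WithZero.exp_zero, WithZero.exp_le_exp]
  have hi : ((i : ℕ) : ℤ) < m := by exact_mod_cast i.2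
  have hi0 : (0 : ℤ) ≤ (i : ℕ) := by positivity
  -- If `log (Q.val (c i)) ≥ 1`, then `log (Q.val a) ≥ -1` makes the left side of `h3` at least `m -
  -- i > 0`.
  by_contra! hcon
  nlinarith

omit [Algebra k E] [IsScalarTower k F E] in
theorem isIntegral_root_of_val_le_one (hm : 0 < m) (hy : y ^ m = algebraMap F E a)
    (hQ : Q.val a ≤ 1) : IsIntegral Q.integers y :=
  IsIntegral.of_pow hm (hy ▸ (Place.isIntegral_integers_iff Q a).2 hQ)

theorem isIntegralBasis (hm : 0 < m) (hω : IsPrimitiveRoot ω m)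
    (hy : y ^ m = algebraMap F E a) (ha : a ≠ 0)
    (hE : IntermediateField.adjoin F {y} = ⊤) (hfin : Module.finrank F E = m) [IsGalois F E]
    (hQ : WithZero.exp (-1) ≤ Q.val a) (hQ1 : Q.val a ≤ 1) :
    Q.IsIntegralBasis (fun i : Fin m => y ^ (i : ℕ)) := by
  constructor
  · exact (linearIndependent_pow hm hy hE hfin).restrict_scalars' Q.integers
  · apply le_antisymm
    · rw [Submodule.span_le]
      rintro _ ⟨i, rfl⟩
      exact (isIntegral_root_of_val_le_one hm hy hQ1).pow _
    · intro z hz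
      obtain ⟨c, rfl⟩ := exists_eq_sum hm hy hE hfin z
      refine Submodule.sum_mem _ fun i _ => ?_
      let ci : Q.integers := ⟨c i, val_coeff_le_one hm hω hy ha hE hfin hQ c hz i⟩
      rw [show algebraMap F E (c i) * y ^ (i : ℕ) = ci • y ^ (i : ℕ) from
        (Algebra.smul_def ci (y ^ (i : ℕ))).symm]
      exact Submodule.smul_mem _ ci
        (Submodule.subset_span ⟨i, rfl⟩)

end IntegralBasis

/-! ### Complete splitting. -/

section Split

variable {ω : kˣ} {Q : Place k F}

/-- The coordinates `c i` of an integral element are integral, so replacing `y` by its residue `b`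
moves the element into `F` modulo the place. Its membership in the center is then decided by `Q` and
`b` alone. -/
theorem eq_of_val_sub_lt_one (hm : 0 < m) (hω : IsPrimitiveRoot ω m)
    (hy : y ^ m = algebraMap F E a) (ha : a ≠ 0)
    (hE : IntermediateField.adjoin F {y} = ⊤) (hfin : Module.finrank F E = m) [IsGalois F E]
    (hQ : Q.val a = 1) {P P' : Place k E} (hP : P.LiesAbove Q) (hP' : P'.LiesAbove Q) (b : k)
    (hb : P.val (y - algebraMap k E b) < 1) (hb' : P'.val (y - algebraMap k E b) < 1) :
    P = P' := by
  have := finiteDimensional hm hy hE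
  have := integralClosure.isDedekindDomain Q.integers F E
  have := integralClosure.isFractionRing_of_finite_extension (A := Q.integers) F E
  refine eq_of_center_eq (integralClosure Q.integers E)
    (fun z => hP.val_le_one_of_isIntegral z.2) (fun z => hP'.val_le_one_of_isIntegral z.2) ?_
  rintro ⟨z, hz⟩
  obtain ⟨c, rfl⟩ := exists_eq_sum hm hy hE hfin z
  have hc := val_coeff_le_one hm hω hy ha hE hfin
    (hQ ▸ (WithZero.lt_one_iff_le_exp_neg_one.2 le_rfl).le) c hz
  have key : ∀ P : Place k E, P.LiesAbove Q → P.val (y - algebraMap k E b) < 1 →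
      (P.val (∑ i, algebraMap F E (c i) * y ^ (i : ℕ)) < 1 ↔
        Q.val (∑ i, c i * algebraMap k F b ^ (i : ℕ)) < 1) := by
    intro P hP hb
    have hy1 := hP.val_le_one_of_isIntegral (isIntegral_root_of_val_le_one hm hy hQ.le)
    have hpow : ∀ n : ℕ, P.val (y ^ n - algebraMap k E b ^ n) < 1 := by
      intro n
      induction n with
      | zero => simp
      | succ n ih =>
        have : y ^ (n + 1) - algebraMap k E b ^ (n + 1) = y ^ n * (y - algebraMap k E b) +
            algebraMap k E b * (y ^ n - algebraMap k E b ^ n) := by ring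
        rw [this]
        refine P.val.map_add_lt ?_ ?_ <;> rw [map_mul]
        · rw [map_pow]
          exact mul_lt_one_of_nonneg_of_lt_one_right (pow_le_one' hy1 n) zero_le hb
        · exact mul_lt_one_of_nonneg_of_lt_one_right (P.val_algebraMap_le_one b) zero_le ih
    have hdiff : P.val (∑ i, algebraMap F E (c i) * y ^ (i : ℕ) -
        algebraMap F E (∑ i, c i * algebraMap k F b ^ (i : ℕ))) < 1 := by
      rw [map_sum, ← Finset.sum_sub_distrib]
      refine P.val.map_sum_lt one_ne_zero fun i _ => ?_
      rw [map_mul, map_pow, ← IsScalarTower.algebraMap_apply, ← mul_sub, map_mul]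
      exact mul_lt_one_of_nonneg_of_lt_one_right (((liesAbove_iff P Q).1 hP _).2 (hc i)) zero_le
        (hpow i)
    rw [← hP.val_lt_one_iff]
    constructor
    · intro h
      have := P.val.map_sub_lt h hdiff
      rwa [sub_sub_cancel] at this
    · intro h
      have := P.val.map_add_lt hdiff h
      rwa [sub_add_cancel] at this
  exact (key P hP hb).trans (key P' hP' hb').symm

theorem splitsCompletely (hm : 0 < m) (hω : IsPrimitiveRoot ω m)
    (hy : y ^ m = algebraMap F E a) (ha : a ≠ 0)
    (hE : IntermediateField.adjoin F {y} = ⊤) (hfin : Module.finrank F E = m) [IsGalois F E]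
    {α : k} (hα : α ≠ 0) (hQ : Q.EvalEq a (α ^ m)) : Q.SplitsCompletely E := by
  have := finiteDimensional hm hy hE
  rw [evalEq_iff] at hQ
  have hαm : Q.val (algebraMap k F (α ^ m)) = 1 := Q.val_algebraMap _ (pow_ne_zero _ hα)
  have hQa : Q.val a = 1 := (Valuation.map_eq_of_sub_lt _ (hαm ▸ hQ)).trans hαm
  have hωk : IsPrimitiveRoot (ω : k) m := IsPrimitiveRoot.coe_units_iff.2 hω
  have hωE : IsPrimitiveRoot (algebraMap k E ω) m :=
    hωk.map_of_injective (algebraMap k E).injective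
  have : NeZero m := ⟨hm.ne'⟩
  have hex : ∀ P : {P : Place k E | P.LiesAbove Q}, ∃ j : Fin m,
      P.1.val (y - algebraMap k E (ω ^ (j : ℕ) * α)) < 1 := by
    rintro ⟨P, hP⟩
    have hlt := (hP.val_lt_one_iff _).2 hQ
    rw [map_sub, ← hy, ← IsScalarTower.algebraMap_apply, map_pow,
      hωE.pow_sub_pow_eq_prod_sub_mul y (algebraMap k E α) hm, map_prod] at hlt
    by_contra! hcon
    -- If no factor `y - ζα` had value below 1, neither would the product `y^m - α^m`.
    refine absurd hlt (not_lt.2 (Finset.one_le_prod' fun ζ hζ => ?_))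
    obtain ⟨j, hj, rfl⟩ := hωE.eq_pow_of_pow_eq_one
      ((Polynomial.mem_nthRootsFinset hm _).1 hζ)
    simpa using hcon ⟨j, hj⟩
  choose g hg using hex
  have huniq : ∀ (P : {P : Place k E | P.LiesAbove Q}) (j : Fin m),
      P.1.val (y - algebraMap k E (ω ^ (j : ℕ) * α)) < 1 → g P = j := by
    intro P j hj
    by_contra hne
    -- Two different residues would differ by a nonzero constant, which has value 1.
    have hsub := P.1.val.map_sub_lt hj (hg P)
    rw [sub_sub_sub_cancel_left, ← map_sub, ← sub_mul, P.1.val_algebraMap] at hsub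
    · exact lt_irrefl _ hsub
    · refine mul_ne_zero (sub_ne_zero.2 fun h => hne ?_) hα
      exact Fin.ext (hωk.pow_inj (g P).2 j.2 h)
  have hbij : Function.Bijective g := by
    constructor
    · intro P P' h
      exact Subtype.ext (eq_of_val_sub_lt_one hm hω hy ha hE hfin hQa P.2 P'.2 _ (hg P)
        (h ▸ hg P'))
    · intro j
      obtain ⟨P, hP⟩ := exists_liesAbove E Q
      set i := g ⟨P, hP⟩ with hi
      -- Pulling back along `y ↦ ω^(j-i) y` changes the residue of `y` from `ω^i α` to `ω^j α`.
      obtain ⟨σ, hσ⟩ := exists_algEquiv hm hω hy ha hE hfin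
        (c := ω ^ (j : ℕ) / ω ^ (i : ℕ))
        (div_mem (Subgroup.npow_mem_zpowers _ _) (Subgroup.npow_mem_zpowers _ _))
      refine ⟨⟨P.conj σ, hP.conj σ⟩, huniq _ _ ?_⟩
      set r : k := ((ω ^ (j : ℕ) / ω ^ (i : ℕ) : kˣ) : k)
      have hr : (ω : k) ^ (j : ℕ) = r * ω ^ (i : ℕ) := by
        simp [r]
      have h1 : σ (y - algebraMap k E (ω ^ (j : ℕ) * α)) =
          algebraMap k E r * (y - algebraMap k E (ω ^ (i : ℕ) * α)) := by
        rw [map_sub, hσ, IsScalarTower.algebraMap_apply k F E (ω ^ (j : ℕ) * α), σ.commutes,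
          ← IsScalarTower.algebraMap_apply, hr]
        simp only [map_mul]
        ring
      refine (congrArg P.val h1).trans_lt ?_
      rw [map_mul]
      exact mul_lt_one_of_nonneg_of_lt_one_right (P.val_algebraMap_le_one r) zero_le
        (hg ⟨P, hP⟩)
  rw [SplitsCompletely, hfin, Set.encard, ENat.card_congr (Equiv.ofBijective g hbij)]
  simp

end Split

end Kummer
end

/-! ### Assembly for the rational function field. -/

theorem mainTheorem5 {Fq : Type*} [Field Fq] [Finite Fq]
    {E : Type*} [Field E] [Algebra (RatFunc Fq) E] [Algebra Fq E]
    [IsScalarTower Fq (RatFunc Fq) E]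
    (m : ℕ) (hm : 0 < m) (ω : Fqˣ) (hω : IsPrimitiveRoot ω m)
    (u : Polynomial Fq) (hu : Squarefree u) (hd : Nat.gcd u.natDegree m = 1)
    (y : E) (hy : y ^ m = algebraMap (RatFunc Fq) E (algebraMap (Polynomial Fq) (RatFunc Fq) u))
    (hE : IntermediateField.adjoin (RatFunc Fq) {y} = ⊤) :
    -- the extension is cyclic of degree `m`
    (IsGalois (RatFunc Fq) E ∧ Module.finrank (RatFunc Fq) E = m ∧
      ∃ φ : (E ≃ₐ[RatFunc Fq] E) ≃* Subgroup.zpowers ω,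
        ∀ σ : E ≃ₐ[RatFunc Fq] E, σ y = algebraMap Fq E ((φ σ : Fqˣ) : Fq) * y) ∧
    -- there is a unique pole `Q∞` of `x`, it is rational and totally ramified
    (∃ Qinf : Place Fq (RatFunc Fq),
      (∀ Q : Place Fq (RatFunc Fq), Q.IsPole RatFunc.X ↔ Q = Qinf) ∧
      Qinf.IsRational ∧
      (∃ Pinf : Place Fq E,
        (∀ P : Place Fq E, P.LiesAbove Qinf ↔ P = Pinf) ∧
        Pinf.HasRamificationIndex Qinf (Module.finrank (RatFunc Fq) E) ∧
        Pinf.ord (algebraMap (RatFunc Fq) E RatFunc.X) = ((-(m : ℤ) : ℤ) : WithTop ℤ) ∧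
        Pinf.ord y = ((-(u.natDegree : ℤ) : ℤ) : WithTop ℤ)) ∧
      -- integral basis at every other place
      (∀ Q : Place Fq (RatFunc Fq), Q ≠ Qinf →
        Q.IsIntegralBasis (fun i : Fin m => y ^ (i : ℕ)))) ∧
    -- complete splitting
    (∀ Q : Place Fq (RatFunc Fq), Q.IsRational →
      (∃ α : Fq, α ≠ 0 ∧ Q.EvalEq (algebraMap (Polynomial Fq) (RatFunc Fq) u) (α ^ m)) →
      Q.SplitsCompletely E) := by

  set a := algebraMap (Polynomial Fq) (RatFunc Fq) u
  have ha : a ≠ 0 := by simpa [a] using hu.ne_zero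
  have hlog : WithZero.log ((Place.infty Fq).val a) = u.natDegree := by
    rw [Place.val_infty_polynomial u hu.ne_zero, WithZero.log_exp]
  have hv : IsCoprime (WithZero.log ((Place.infty Fq).val a)) (m : ℤ) := by
    rw [hlog]
    exact Nat.isCoprime_iff_coprime.2 hd
  have hfin := Kummer.finrank_eq_of_valuation hm hy hE _ hv
  have hgal : IsGalois (RatFunc Fq) E := Kummer.isGalois hm hy hE hfin
    ((IsPrimitiveRoot.coe_units_iff.2 hω).map_of_injective
      (algebraMap Fq (RatFunc Fq)).injective)
  have := Kummer.finiteDimensional hm hy hE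
  have hm0 : (m : ℤ) ≠ 0 := by exact_mod_cast hm.ne'
  refine ⟨⟨hgal, hfin, Kummer.exists_mulEquiv hm hω hy ha hE hfin⟩,
    ⟨Place.infty Fq, Place.isPole_X_iff, Place.isRational_infty, ?_, fun Q hQ => ?_⟩, ?_⟩
  · obtain ⟨P, hP⟩ := Place.exists_liesAbove E (Place.infty Fq)
    have hram := Kummer.hasRamificationIndex hm hy hE hfin hv hP
    have hX := hram.2 RatFunc.X
    have hu' := hram.2 a
    have hy0 : y ≠ 0 := by
      rintro rfl
      rw [zero_pow hm.ne'] at hy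
      exact ha (by simpa using hy.symm)
    refine ⟨P, fun P' => ⟨fun h => Kummer.liesAbove_unique hm hy hE hfin hv h hP,
      fun h => h ▸ hP⟩, hfin.symm ▸ hram, ?_, ?_⟩
    · rw [P.ord_of_ne_zero (by simpa using RatFunc.X_ne_zero), hX, Place.val_infty _
        RatFunc.X_ne_zero, RatFunc.intDegree_X, WithZero.log_pow, WithZero.log_exp]
      simp
    · have h := congrArg WithZero.log hu'
      rw [← hy, map_pow, WithZero.log_pow, WithZero.log_pow, hlog, nsmul_eq_mul,
        nsmul_eq_mul] at h
      rw [P.ord_of_ne_zero hy0, mul_left_cancel₀ hm0 h]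
  · obtain ⟨h1, h2⟩ := Place.val_squarefree Q hQ hu
    exact Kummer.isIntegralBasis hm hω hy ha hE hfin h1 h2
  · rintro Q - ⟨α, hα, hQ⟩
    exact Kummer.splitsCompletely hm hω hy ha hE hfin hα hQ
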